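/- Let $G$ be a finite-dimensional real (smooth) Lie group with neutral element $1$, let $\mathfrak{X}(G)$ be the space of smooth vector fields on $G$, and write $L_g(x)=gx$. A (smooth) Koszul connection $\nabla$ on $TG$ is called left invariant if $L_g^*(\nabla_XY)=\nabla_{L_g^*X}(L_g^*Y)$ for all $g\in G$ and $X,Y\in\mathfrak{X}(G)$. Its torsion and curvature are $T(X,Y)=\nabla_XY-\nabla_YX-[X,Y]$ and $R(X,Y)Z=\nabla_X\nabla_YZ-\nabla_Y\nabla_XZ-\nabla_{[X,Y]}Z$. A left invariant locally flat (affine) structure on $G$ is a left invariant Koszul connection with $T=0$ and $R=0$. For a smooth vector field $X$ put $$(\nabla^2X)(Y,Z)=\nabla_Y\nabla_ZX-\nabla_{\nabla_YZ}X .$$ Let $J_\nabla$ be the space of all $X\in\mathfrak{X}(G)$ with $\nabla^2X=0$, let $\mathcal{T}_\nabla G(1)=\{X(1): X\in J_\nabla\}\subset T_1G$, and let $r^b(\nabla)=\dim\mathcal{T}_\nabla G(1)$. Define $$r^b(G)=\min_{\nabla}\{\dim G-r^b(\nabla)\},$$ the minimum being over all left invariant torsion-free Koszul connections $\nabla$ on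 $G$. **Theorem.** The following assertions are equivalent: (1) $r^b(G)=0$; (2) $G$ admits a left invariant locally flat structure. The same equivalence holds if $\mathcal{T}_\nabla G(1)$ is replaced in the definition of $r^b$ by the subspace of $T_1G$ spanned by the values at $1$ of the solutions of $\nabla^2X=0$ that are defined on some open neighbourhood of $1$. -/

import Mathlib

open scoped Manifold ContDiff

noncomputable section

namespace LeftInvariantGauge

universe u v

variable {E : Type u} [NormedAddCommGroup E] [NormedSpace ℝ E]
  {G : Type v} [TopologicalSpace G] [ChartedSpace E G]

/-- Vector fields on the manifold `G` (no regularity imposed). -/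
abbrev VField (E : Type u) [NormedAddCommGroup E] [NormedSpace ℝ E]
    (G : Type v) [TopologicalSpace G] [ChartedSpace E G] : Type (max u v) :=
  ∀ x : G, TangentSpace 𝓘(ℝ, E) x

/-- The vector field `X` is of class `C^∞` on the set `U`. -/
def SmoothOn [IsManifold 𝓘(ℝ, E) 1 G] (X : VField E G) (U : Set G) : Prop :=
  ContMDiffOn 𝓘(ℝ, E) 𝓘(ℝ, E).tangent ∞
    (fun x => (⟨x, X x⟩ : TangentBundle 𝓘(ℝ, E) G)) U

/-- Koszul connections (covariant derivatives on the tangent bundle) of `G`;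
`D Y x (X x)` is the value at `x` of `∇_X Y`. -/
abbrev Connection (E : Type u) [NormedAddCommGroup E] [NormedSpace ℝ E]
    (G : Type v) [TopologicalSpace G] [ChartedSpace E G] [IsManifold 𝓘(ℝ, E) 1 G] :
    Type (max u v) :=
  CovariantDerivative 𝓘(ℝ, E) E (TangentSpace 𝓘(ℝ, E) : G → Type u)

/-- The vector field `∇_X Y`. -/
def nabla [IsManifold 𝓘(ℝ, E) 1 G] (D : Connection E G) (X Y : VField E G) : VField E G :=
  fun x => D Y x (X x)

/-- Curvature: `R(X, Y) Z = ∇_X ∇_Y Z - ∇_Y ∇_X Z - ∇_[X,Y] Z`. -/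
def curvature [IsManifold 𝓘(ℝ, E) 1 G] (D : Connection E G) (X Y Z : VField E G) :
    VField E G :=
  nabla D X (nabla D Y Z) - nabla D Y (nabla D X Z)
    - nabla D (VectorField.mlieBracket 𝓘(ℝ, E) X Y) Z

/-- `(∇²X)(Y, Z) = ∇_Y ∇_Z X - ∇_(∇_Y Z) X`. -/
def nablaSq [IsManifold 𝓘(ℝ, E) 1 G] (D : Connection E G) (X Y Z : VField E G) :
    VField E G :=
  nabla D Y (nabla D Z X) - nabla D (nabla D Y Z) X

/-- The curvature tensor of `D` vanishes. -/
def IsFlat [IsManifold 𝓘(ℝ, E) 1 G] (D : Connection E G) : Prop :=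
  ∀ X Y Z : VField E G, SmoothOn X Set.univ → SmoothOn Y Set.univ → SmoothOn Z Set.univ →
    curvature D X Y Z = 0

/-- `X` is a smooth solution of `∇²X = 0` on `U` (values of `X` off `U` are irrelevant
when `U` is open). -/
def IsSolutionOn [IsManifold 𝓘(ℝ, E) 1 G] (D : Connection E G) (X : VField E G)
    (U : Set G) : Prop :=
  SmoothOn X U ∧
    ∀ Y Z : VField E G, SmoothOn Y Set.univ → SmoothOn Z Set.univ →
      ∀ x ∈ U, nablaSq D X Y Z x = 0

variable [Group G]

/-- Left invariance: `(L_g)^* (∇_X Y) = ∇_((L_g)^* X) ((L_g)^* Y)` for every `g` and all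
smooth vector fields, with `L_g x = g * x`. -/
def IsLeftInvariant [IsManifold 𝓘(ℝ, E) 1 G] (D : Connection E G) : Prop :=
  ∀ (g : G) (X Y : VField E G), SmoothOn X Set.univ → SmoothOn Y Set.univ →
    VectorField.mpullback 𝓘(ℝ, E) 𝓘(ℝ, E) (fun x => g * x) (nabla D X Y) =
      nabla D (VectorField.mpullback 𝓘(ℝ, E) 𝓘(ℝ, E) (fun x => g * x) X)
        (VectorField.mpullback 𝓘(ℝ, E) 𝓘(ℝ, E) (fun x => g * x) Y)

/-- The subspace of `T_1 G` spanned by the values at `1` of the solutions of `∇²X = 0` that are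
defined on all of `G`. -/
def solutionSpan [IsManifold 𝓘(ℝ, E) 1 G] (D : Connection E G) :
    Submodule ℝ (TangentSpace 𝓘(ℝ, E) (1 : G)) :=
  Submodule.span ℝ {w | ∃ X : VField E G, IsSolutionOn D X Set.univ ∧ X 1 = w}

/-- The subspace of `T_1 G` spanned by the values at `1` of the solutions of `∇²X = 0` that are
defined on some open neighbourhood of `1`. -/
def localSolutionSpan [IsManifold 𝓘(ℝ, E) 1 G] (D : Connection E G) :
    Submodule ℝ (TangentSpace 𝓘(ℝ, E) (1 : G)) :=
  Submodule.span ℝ {w | ∃ (U : Set G) (X : VField E G),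
    IsOpen U ∧ (1 : G) ∈ U ∧ IsSolutionOn D X U ∧ X 1 = w}

section FiniteDim

variable [FiniteDimensional ℝ E] [LieGroup 𝓘(ℝ, E) ∞ G]

/-- `D` is a smooth left invariant torsion-free (symmetric) connection. -/
structure IsSLC (D : Connection E G) : Prop where
  smooth : CovariantDerivative.ContMDiffCovariantDerivative D ∞
  leftInvariant : IsLeftInvariant D
  torsionFree : D.torsion = 0

variable (E G)

/-- `r^b(G)`: the minimum of `dim G - dim (solutionSpan D)` over all smooth left invariant
torsion-free connections `D` (an infimum in `ℕ∞`, so attained). -/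
def rb : ℕ∞ :=
  ⨅ D : {D : Connection E G // IsSLC D},
    ((Module.finrank ℝ E - Module.finrank ℝ (solutionSpan D.1) : ℕ) : ℕ∞)

/-- The variant of `r^b(G)` in which solutions need only be defined near `1`. -/
def rbLocal : ℕ∞ :=
  ⨅ D : {D : Connection E G // IsSLC D},
    ((Module.finrank ℝ E - Module.finrank ℝ (localSolutionSpan D.1) : ℕ) : ℕ∞)

/-- `G` carries a left invariant locally flat structure: a smooth left invariant connection with
vanishing torsion and vanishing curvature. -/
def AdmitsLeftInvariantLocallyFlat : Prop :=
  ∃ D : Connection E G, IsSLC D ∧ IsFlat D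

end FiniteDim

end LeftInvariantGauge

end

/-! Everything rests on one identity: for torsion-free `∇`, `R(Y,Z)X = (∇²X)(Y,Z) - (∇²X)(Z,Y)`
(`curvature_eq_nablaSq_sub`). If the values at `1` of local solutions of `∇²X = 0` span `T_1 G`,
tensoriality of `R` in its last argument turns this identity into `R = 0` at `1`, and left
invariance carries that to all of `G` (`isFlat_of_localSolutionSpan_eq_top`). Conversely, let `∇` be
flat and `X` right invariant. Then `X` commutes with every left invariant field `L`, so `∇_L X = ∇_X
L`. Since `∇_L L'` is again left invariant, `(∇²X)(L,L') = ∇_L ∇_X L' - ∇_X ∇_L L' = R(L,X)L' = 0`.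
As `∇²X` is tensorial, `X` is a global solution, and right invariant fields take every value at `1`
(`solutionSpan_eq_top_of_isFlat`). Global solutions are local ones, so both versions of the
invariant vanish together. -/

noncomputable section

namespace LeftInvariantGauge

universe u v

/-! ### Invariant vector fields and left translation to the identity. -/

section InvariantFields

variable {E : Type u} [NormedAddCommGroup E] [NormedSpace ℝ E]
  {G : Type v} [TopologicalSpace G] [ChartedSpace E G] [Group G] [LieGroup 𝓘(ℝ, E) ∞ G]

instance lieGroup_minSmoothness : LieGroup 𝓘(ℝ, E) (minSmoothness ℝ 3) G :=
  LieGroup.of_le (n := ∞) (by simp only [minSmoothness_of_isRCLikeNormedField]; exact WithTop.coe_le_coe.2 le_top)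

/-- The tangent map of multiplication is smooth and is the sum of its two partial derivatives.
Taking one of the two vectors to be zero gives smoothness of the invariant fields and of
`maurerCartan`. -/
lemma contMDiffOn_tangent_mul {U : Set G} {p q : G → G}
    {X : ∀ x, TangentSpace 𝓘(ℝ, E) (p x)} {Y : ∀ x, TangentSpace 𝓘(ℝ, E) (q x)}
    (hX : ContMDiffOn 𝓘(ℝ, E) 𝓘(ℝ, E).tangent ∞
      (fun x => (⟨p x, X x⟩ : TangentBundle 𝓘(ℝ, E) G)) U)
    (hY : ContMDiffOn 𝓘(ℝ, E) 𝓘(ℝ, E).tangent ∞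
      (fun x => (⟨q x, Y x⟩ : TangentBundle 𝓘(ℝ, E) G)) U) :
    ContMDiffOn 𝓘(ℝ, E) 𝓘(ℝ, E).tangent ∞
      (fun x => (⟨p x * q x, mfderiv 𝓘(ℝ, E) 𝓘(ℝ, E) (fun y => y * q x) (p x) (X x)
        + mfderiv 𝓘(ℝ, E) 𝓘(ℝ, E) (fun y => p x * y) (q x) (Y x)⟩ :
        TangentBundle 𝓘(ℝ, E) G)) U := by
  have S₂ : ContMDiff _ _ ∞ (equivTangentBundleProd 𝓘(ℝ, E) G 𝓘(ℝ, E) G).symm :=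
    contMDiff_equivTangentBundleProd_symm
  have S₃ : ContMDiff _ _ ∞ (tangentMap (𝓘(ℝ, E).prod 𝓘(ℝ, E)) 𝓘(ℝ, E)
      (fun z : G × G => z.1 * z.2)) :=
    ContMDiff.contMDiff_tangentMap (n := ∞) (contMDiff_mul 𝓘(ℝ, E) ∞) (by simp)
  have := (S₃.comp S₂).comp_contMDiffOn (hX.prodMk hY)
  convert! this with x
  simp only [Function.comp_apply, tangentMap]
  rw [mfderiv_prod_eq_add_apply ((contMDiff_mul 𝓘(ℝ, E) ∞).mdifferentiableAt (by simp))]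
  rfl

lemma smoothOn_mulInvariantVectorField (v : TangentSpace 𝓘(ℝ, E) (1 : G)) (U : Set G) :
    SmoothOn (mulInvariantVectorField (I := 𝓘(ℝ, E)) v) U := by
  have h := contMDiffOn_tangent_mul (E := E) (G := G) (U := U) (p := id) (q := fun _ => 1)
    (X := fun x => (0 : TangentSpace 𝓘(ℝ, E) x)) (Y := fun _ => v)
    (Bundle.contMDiff_zeroSection ℝ (TangentSpace 𝓘(ℝ, E) : G → Type u)).contMDiffOn
    contMDiffOn_const
  unfold SmoothOn
  convert! h with x
  · simp
  · simp [mulInvariantVectorField]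
    rfl

/-- The right invariant vector field with value `v` at `1`. -/
def rightInvariantVectorField (v : TangentSpace 𝓘(ℝ, E) (1 : G)) : VField E G :=
  fun x => (mfderiv 𝓘(ℝ, E) 𝓘(ℝ, E) (fun y : G => y * x) (1 : G) v : E)

lemma smoothOn_rightInvariantVectorField (v : TangentSpace 𝓘(ℝ, E) (1 : G)) (U : Set G) :
    SmoothOn (rightInvariantVectorField (E := E) v) U := by
  have h := contMDiffOn_tangent_mul (E := E) (G := G) (U := U) (p := fun _ => 1) (q := id)
    (Y := fun x => (0 : TangentSpace 𝓘(ℝ, E) x)) (X := fun _ => v)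
    contMDiffOn_const
    (Bundle.contMDiff_zeroSection ℝ (TangentSpace 𝓘(ℝ, E) : G → Type u)).contMDiffOn
  unfold SmoothOn
  convert! h with x
  · simp
  · simp [rightInvariantVectorField]
    rfl

omit [LieGroup 𝓘(ℝ, E) ∞ G] in
lemma mfderiv_one_of_eq_id {f : G → G} (hf : f = id) :
    (mfderiv 𝓘(ℝ, E) 𝓘(ℝ, E) f (1 : G) : E →L[ℝ] E) = ContinuousLinearMap.id ℝ E := by
  subst hf
  exact mfderiv_id

omit [LieGroup 𝓘(ℝ, E) ∞ G] in
lemma rightInvariantVectorField_one (v : TangentSpace 𝓘(ℝ, E) (1 : G)) :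
    rightInvariantVectorField (E := E) v (1 : G) = v :=
  congr($(mfderiv_one_of_eq_id (E := E) (f := fun y : G => y * 1) (by ext; simp)) v)

omit [LieGroup 𝓘(ℝ, E) ∞ G] in
lemma mulInvariantVectorField_one (v : TangentSpace 𝓘(ℝ, E) (1 : G)) :
    mulInvariantVectorField v (1 : G) = v :=
  congr($(mfderiv_one_of_eq_id (E := E) (f := fun y : G => 1 * y) (by ext; simp)) v)

/-- The left translate to `1` of the vector `X x`. -/
def maurerCartan (X : VField E G) (x : G) : TangentSpace 𝓘(ℝ, E) (1 : G) :=
  (mfderiv 𝓘(ℝ, E) 𝓘(ℝ, E) (fun y : G => x⁻¹ * y) x (X x) : E)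

lemma mulInvariantVectorField_maurerCartan (X : VField E G) (x : G) :
    mulInvariantVectorField (maurerCartan X x) x = X x := by
  have h : (fun y : G => x * y) ∘ (fun y => x⁻¹ * y) = id := by ext; simp
  have h2 := mfderiv_comp (I := 𝓘(ℝ, E)) (I' := 𝓘(ℝ, E)) (I'' := 𝓘(ℝ, E)) x
    (f := fun y => x⁻¹ * y) (g := fun y : G => x * y)
    ((contMDiff_mul_left (I := 𝓘(ℝ, E)) (n := ∞)).mdifferentiableAt (by simp))
    ((contMDiff_mul_left (I := 𝓘(ℝ, E)) (n := ∞)).mdifferentiableAt (by simp))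
  rw [h, mfderiv_id] at h2
  have h3 := congr($h2 (X x))
  -- `x⁻¹ * x` equals `1` only propositionally; reading the derivatives as maps `E →L[ℝ] E` lets the
  -- base point be substituted.
  have h4 : ∀ z : G, z = 1 → (mfderiv 𝓘(ℝ, E) 𝓘(ℝ, E) (fun y : G => x * y) 1 : E →L[ℝ] E)
      = mfderiv 𝓘(ℝ, E) 𝓘(ℝ, E) (fun y : G => x * y) z := by
    rintro z rfl; rfl
  refine Eq.trans ?_ h3.symm
  exact congr($(h4 (x⁻¹ * x) (by simp)) (maurerCartan X x))

lemma contMDiffOn_maurerCartan {X : VField E G} {U : Set G} (hX : SmoothOn X U) :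
    ContMDiffOn 𝓘(ℝ, E) 𝓘(ℝ, E) ∞ (M' := E) (fun x => maurerCartan X x) U := by
  have h0 : ContMDiffOn 𝓘(ℝ, E) 𝓘(ℝ, E).tangent ∞
      (fun x => (⟨x⁻¹, 0⟩ : TangentBundle 𝓘(ℝ, E) G)) U :=
    ((Bundle.contMDiff_zeroSection ℝ (TangentSpace 𝓘(ℝ, E) : G → Type u)).comp
      (contMDiff_inv 𝓘(ℝ, E) ∞)).contMDiffOn
  have h := contMDiffOn_tangent_mul h0 hX
  have h' : ContMDiffOn 𝓘(ℝ, E) 𝓘(ℝ, E).tangent ∞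
      (fun x => (⟨1, maurerCartan X x⟩ : TangentBundle 𝓘(ℝ, E) G)) U := by
    convert! h with x
    · simp
    · simp [maurerCartan]
      rfl
  intro x hx
  have h2 := (Bundle.contMDiffWithinAt_totalSpace.1 (h' x hx)).2
  refine h2.congr_of_mem (fun y hy => ?_) hx
  -- Over the constant base point `1`, the trivialization at `1` acts on the fibre as the identity.
  exact ((tangentBundleCore 𝓘(ℝ, E) G).coordChange_self (achart E 1) 1
    (mem_achart_source E 1) _).symm

end InvariantFields

/-! ### Local calculus of `∇`, and `∇²` as a tensor. -/

section Connection

variable {E : Type u} [NormedAddCommGroup E] [NormedSpace ℝ E]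
  {G : Type v} [TopologicalSpace G] [ChartedSpace E G] [IsManifold 𝓘(ℝ, E) ∞ G]
  {D : Connection E G} {X X' Y Z W S : VField E G} {c : G → ℝ} {U : Set G} {x : G}

lemma SmoothOn.mdifferentiableAt (hX : SmoothOn X U) (hU : IsOpen U) (hx : x ∈ U) :
    MDiffAt (T% X) x :=
  (ContMDiffOn.contMDiffAt hX (hU.mem_nhds hx)).mdifferentiableAt (by simp)

lemma SmoothOn.mdifferentiableAt_of_univ (hX : SmoothOn X Set.univ) : MDiffAt (T% X) x :=
  hX.mdifferentiableAt isOpen_univ trivial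

lemma SmoothOn.contMDiffAt_two (hX : SmoothOn X U) (hU : IsOpen U) (hx : x ∈ U) :
    CMDiffAt (minSmoothness ℝ 2) (T% X) x :=
  (ContMDiffOn.contMDiffAt hX (hU.mem_nhds hx)).of_le
    (by simp only [minSmoothness_of_isRCLikeNormedField]; exact WithTop.coe_le_coe.2 le_top)

lemma smoothOn_nabla (hD : CovariantDerivative.ContMDiffCovariantDerivative D ∞)
    (hX : SmoothOn X Set.univ) (hY : SmoothOn Y Set.univ) :
    SmoothOn (nabla D X Y) Set.univ :=
  ContMDiffOn.clm_bundle_apply (hD.contMDiff.contMDiff (by simpa [SmoothOn] using hY)) hX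

lemma mdifferentiableAt_nabla (hD : CovariantDerivative.ContMDiffCovariantDerivative D ∞)
    (hX : MDiffAt (T% X) x) (hY : SmoothOn Y Set.univ) :
    MDiffAt (T% (nabla D X Y)) x :=
  MDifferentiableAt.clm_bundle_apply
    ((ContMDiffOn.contMDiffAt (hD.contMDiff.contMDiff (by simpa [SmoothOn] using hY))
      Filter.univ_mem).mdifferentiableAt (by simp)) hX

lemma nabla_smul (hc : MDiffAt c x) (hS : MDiffAt (T% S) x) :
    nabla D X (c • S) x = c x • nabla D X S x + (d% c x (X x)) • S x := by
  simp [nabla, D.isCovariantDerivativeOnUniv.leibniz hS hc]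

lemma nabla_add (hS : MDiffAt (T% S) x) (hW : MDiffAt (T% W) x) :
    nabla D X (S + W) x = nabla D X S x + nabla D X W x := by
  simp [nabla, D.isCovariantDerivativeOnUniv.add hS hW]

lemma nabla_congr (hW : MDiffAt (T% W) x) (h : ∀ᶠ y in nhds x, S y = W y) :
    nabla D X S x = nabla D X W x := by
  have hS : MDiffAt (T% S) x :=
    hW.congr_of_eventuallyEq (h.mono fun y hy => by simp [hy])
  simp only [nabla]
  rw [D.isCovariantDerivativeOnUniv.congr_of_eventuallyEq hS hW Filter.univ_mem h]

lemma contMDiffOn_mvfderiv (hU : IsOpen U) (hc : ContMDiffOn 𝓘(ℝ, E) 𝓘(ℝ, ℝ) ∞ c U)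
    (hX : SmoothOn X U) :
    ContMDiffOn 𝓘(ℝ, E) 𝓘(ℝ, ℝ) ∞ (fun y => (d% c y (X y) : ℝ)) U := by
  have h1 := hc.contMDiffOn_tangentMapWithin (m := ∞) (by simp) hU.uniqueMDiffOn
  have h2 := h1.comp hX (fun y hy => hy)
  have h3 := (contMDiff_snd_tangentBundle_modelSpace ℝ 𝓘(ℝ, ℝ) (n := ∞)).comp_contMDiffOn h2
  refine h3.congr fun y hy => ?_
  change d% c y (X y) = mfderivWithin 𝓘(ℝ, E) 𝓘(ℝ, ℝ) c U y (X y)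
  rw [mfderivWithin_of_isOpen hU hy]
  rfl

lemma smoothOn_mlieBracket [CompleteSpace E]
    (hX : SmoothOn X Set.univ) (hY : SmoothOn Y Set.univ) :
    SmoothOn (VectorField.mlieBracket 𝓘(ℝ, E) X Y) Set.univ := by
  have : IsManifold 𝓘(ℝ, E) ((⊤ : ℕ∞) + 1) G := ‹_›
  have : IsManifold 𝓘(ℝ, E) (minSmoothness ℝ 2) G := IsManifold.of_le (n := ∞)
    (by simp only [minSmoothness_of_isRCLikeNormedField]; exact WithTop.coe_le_coe.2 le_top)
  exact (ContDiff.mlieBracket_vectorField (m := ⊤) (n := ⊤) (contMDiffOn_univ.1 hX)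
    (contMDiffOn_univ.1 hY) (by simp)).contMDiffOn

/-- Replacing `Z` by `fZ` produces the term `(Y f) ∇_Z W` in both halves of `∇²W`, and these cancel.
-/
lemma tensorialAt_nablaSq (hD : CovariantDerivative.ContMDiffCovariantDerivative D ∞)
    (hW : SmoothOn W Set.univ) (x : G) :
    TensorialAt 𝓘(ℝ, E) E (fun Z => nablaSq D W Y Z x) x where
  smul {f σ} hf hσ := by
    have h1 : nabla D (f • σ) W = f • nabla D σ W := by ext y; simp [nabla]
    have h2 := nabla_smul (D := D) (X := Y) hf (mdifferentiableAt_nabla hD hσ hW)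
    have h3 := nabla_smul (D := D) (X := Y) hf hσ
    simp only [nablaSq, Pi.sub_apply, h1, h2]
    simp only [nabla] at h3 ⊢
    rw [h3]
    simp only [map_add, map_smul]
    module
  add {σ τ} hσ hτ := by
    have h1 : nabla D (σ + τ) W = nabla D σ W + nabla D τ W := by ext y; simp [nabla]
    have h2 := nabla_add (D := D) (X := Y) (mdifferentiableAt_nabla hD hσ hW)
      (mdifferentiableAt_nabla hD hτ hW)
    have h3 := nabla_add (D := D) (X := Y) hσ hτ
    simp only [nablaSq, Pi.sub_apply, h1, h2]
    simp only [nabla] at h3 ⊢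
    rw [h3]
    simp only [map_add]
    module

lemma nablaSq_congr [FiniteDimensional ℝ E]
    (hD : CovariantDerivative.ContMDiffCovariantDerivative D ∞) (hW : SmoothOn W Set.univ)
    {Y' Z' : VField E G} (hZ : MDiffAt (T% Z) x) (hZ' : MDiffAt (T% Z') x)
    (hYY : Y x = Y' x) (hZZ : Z x = Z' x) :
    nablaSq D W Y Z x = nablaSq D W Y' Z' x := by
  have h1 : nablaSq D W Y Z x = nablaSq D W Y' Z x := by simp [nablaSq, nabla, hYY]
  rw [h1]
  exact (tensorialAt_nablaSq hD hW x).pointwise hZ hZ' hZZ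

/-- Vanishing torsion lets `[Y,Z]` be replaced by `∇_Y Z - ∇_Z Y`, which supplies exactly the
correction terms of the two `∇²`. No regularity of `W` enters. -/
lemma curvature_eq_nablaSq_sub [FiniteDimensional ℝ E] [IsManifold 𝓘(ℝ, E) 2 G]
    (hT : D.torsion = 0) (hY : MDiffAt (T% Y) x)
    (hZ : MDiffAt (T% Z) x) :
    curvature D Y Z W x = nablaSq D W Y Z x - nablaSq D W Z Y x := by
  have h := D.torsion_eq_zero_iff.1 hT hY hZ
  simp only [curvature, nablaSq, Pi.sub_apply]
  simp only [nabla, ← h, map_sub]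
  abel

open VectorField in
-- This is `[Y,Z]c = Y(Zc) - Z(Yc)`, tested against `S`. Expand the Jacobi identity for `Y`, `Z`, `c
-- • S` by the Leibniz rule and remove `c` times the Jacobi identity for `Y`, `Z`, `S`; the mixed
-- first-order terms cancel.
lemma mvfderiv_mlieBracket_smul [CompleteSpace E] [IsManifold 𝓘(ℝ, E) (minSmoothness ℝ 3) G]
    (hU : IsOpen U) (hx : x ∈ U)
    (hc : ContMDiffOn 𝓘(ℝ, E) 𝓘(ℝ, ℝ) ∞ c U)
    (hY : SmoothOn Y Set.univ) (hZ : SmoothOn Z Set.univ) (hS : SmoothOn S Set.univ) :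
    (d% c x (mlieBracket 𝓘(ℝ, E) Y Z x) : ℝ) • S x =
      (d% (fun y => (d% c y (Z y) : ℝ)) x (Y x) : ℝ) • S x
      - (d% (fun y => (d% c y (Y y) : ℝ)) x (Z x) : ℝ) • S x := by
  have : IsManifold 𝓘(ℝ, E) 2 G := IsManifold.of_le (n := ∞) (WithTop.coe_le_coe.2 le_top)
  have hcS : SmoothOn (c • S) U := hc.smul_section (ContMDiffOn.mono hS (Set.subset_univ _))
  have hcd : ∀ y ∈ U, MDiffAt c y := fun y hy =>
    (hc.contMDiffAt (hU.mem_nhds hy)).mdifferentiableAt (by simp)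
  have key : ∀ V V' : VField E G, SmoothOn V Set.univ → SmoothOn V' Set.univ →
      mlieBracket 𝓘(ℝ, E) V (mlieBracket 𝓘(ℝ, E) V' (c • S)) x =
      (d% (fun y => (d% c y (V' y) : ℝ)) x (V x) : ℝ) • S x
      + (d% c x (V' x) : ℝ) • mlieBracket 𝓘(ℝ, E) V S x
      + ((d% c x (V x) : ℝ) • mlieBracket 𝓘(ℝ, E) V' S x
      + c x • mlieBracket 𝓘(ℝ, E) V (mlieBracket 𝓘(ℝ, E) V' S) x) := by
    intro V V' hV hV'
    have h1 : mlieBracket 𝓘(ℝ, E) V' (c • S) =ᶠ[nhds x]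
        (fun y => (d% c y (V' y) : ℝ)) • S + c • mlieBracket 𝓘(ℝ, E) V' S := by
      filter_upwards [hU.mem_nhds hx] with y hy
      exact mlieBracket_smul_right (hcd y hy) hS.mdifferentiableAt_of_univ
    have hb : MDiffAt (T% (mlieBracket 𝓘(ℝ, E) V' S)) x :=
      (smoothOn_mlieBracket hV' hS).mdifferentiableAt_of_univ
    have hd : MDiffAt (fun y => (d% c y (V' y) : ℝ)) x :=
      ((contMDiffOn_mvfderiv hU hc (ContMDiffOn.mono hV' (Set.subset_univ _))).contMDiffAt
        (hU.mem_nhds hx)).mdifferentiableAt (by simp)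
    rw [Filter.EventuallyEq.mlieBracket_vectorField_eq (Filter.EventuallyEq.refl _ V) h1,
      mlieBracket_add_right (hd.smul_section hS.mdifferentiableAt_of_univ)
        ((hcd x hx).smul_section hb),
      mlieBracket_smul_right hd hS.mdifferentiableAt_of_univ,
      mlieBracket_smul_right (hcd x hx) hb]
  have hJ := leibniz_identity_mlieBracket_apply (hY.contMDiffAt_two isOpen_univ trivial)
    (hZ.contMDiffAt_two isOpen_univ trivial) (hcS.contMDiffAt_two hU hx)
  have hJ' := leibniz_identity_mlieBracket_apply (x := x)
    (hY.contMDiffAt_two isOpen_univ trivial)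
    (hZ.contMDiffAt_two isOpen_univ trivial) (hS.contMDiffAt_two isOpen_univ trivial)
  rw [key Y Z hY hZ, key Z Y hZ hY,
    mlieBracket_smul_right (hcd x hx) hS.mdifferentiableAt_of_univ, hJ'] at hJ
  linear_combination (norm := module) -hJ

end Connection

/-! ### Linearity of curvature over functions in its last argument. -/

section Curvature

variable {E : Type u} [NormedAddCommGroup E] [NormedSpace ℝ E]
  {G : Type v} [TopologicalSpace G] [ChartedSpace E G] [IsManifold 𝓘(ℝ, E) ∞ G]
  {D : Connection E G} {X X' Y Z W W' S : VField E G} {c : G → ℝ} {U : Set G} {x : G}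

/-- `W` is regular enough at `x` for second covariant derivatives to make sense there. -/
def TwiceDifferentiableAt (D : Connection E G) (W : VField E G) (x : G) : Prop :=
  (∀ᶠ y in nhds x, MDiffAt (T% W) y) ∧
    ∀ V : VField E G, SmoothOn V Set.univ → MDiffAt (T% (nabla D V W)) x

lemma eventuallyEq_nabla_add (hW : TwiceDifferentiableAt D W x)
    (hW' : TwiceDifferentiableAt D W' x) :
    ∀ᶠ y in nhds x, nabla D X (W + W') y = (nabla D X W + nabla D X W') y := by
  filter_upwards [hW.1, hW'.1] with y hy hy'
  exact nabla_add hy hy'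

lemma TwiceDifferentiableAt.add (hW : TwiceDifferentiableAt D W x)
    (hW' : TwiceDifferentiableAt D W' x) : TwiceDifferentiableAt D (W + W') x := by
  refine ⟨?_, fun V hV => ?_⟩
  · filter_upwards [hW.1, hW'.1] with y hy hy'
    exact mdifferentiableAt_add_section hy hy'
  · exact (mdifferentiableAt_add_section (hW.2 V hV) (hW'.2 V hV)).congr_of_eventuallyEq
      ((eventuallyEq_nabla_add (X := V) hW hW').mono fun y hy => by simp [hy])

lemma twiceDifferentiableAt_zero : TwiceDifferentiableAt D 0 x := by
  refine ⟨Filter.Eventually.of_forall fun y => Bundle.mdifferentiableAt_zeroSection .., fun V hV => ?_⟩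
  have : nabla D V 0 = 0 := by ext y; simp [nabla]
  rw [this]
  exact Bundle.mdifferentiableAt_zeroSection ..

lemma eventuallyEq_nabla_smul (hU : IsOpen U) (hx : x ∈ U)
    (hc : ContMDiffOn 𝓘(ℝ, E) 𝓘(ℝ, ℝ) ∞ c U) (hS : SmoothOn S Set.univ) :
    ∀ᶠ y in nhds x, nabla D X (c • S) y =
      (c • nabla D X S + (fun y => (d% c y (X y) : ℝ)) • S) y := by
  filter_upwards [hU.mem_nhds hx] with y hy
  exact nabla_smul ((hc.contMDiffAt (hU.mem_nhds hy)).mdifferentiableAt (by simp))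
    hS.mdifferentiableAt_of_univ

lemma mdifferentiableAt_mvfderiv (hU : IsOpen U) (hx : x ∈ U)
    (hc : ContMDiffOn 𝓘(ℝ, E) 𝓘(ℝ, ℝ) ∞ c U) (hX : SmoothOn X Set.univ) :
    MDiffAt (fun y => (d% c y (X y) : ℝ)) x :=
  ((contMDiffOn_mvfderiv hU hc (ContMDiffOn.mono hX (Set.subset_univ _))).contMDiffAt
    (hU.mem_nhds hx)).mdifferentiableAt (by simp)

/-- The coefficient is smooth only on `U`, so `c • S` need not be globally smooth; this pointwise
regularity is what `curvature_add` asks for. -/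
lemma twiceDifferentiableAt_smul (hD : CovariantDerivative.ContMDiffCovariantDerivative D ∞)
    (hU : IsOpen U) (hx : x ∈ U)
    (hc : ContMDiffOn 𝓘(ℝ, E) 𝓘(ℝ, ℝ) ∞ c U) (hS : SmoothOn S Set.univ) :
    TwiceDifferentiableAt D (c • S) x := by
  have hcd : ∀ y ∈ U, MDiffAt c y := fun y hy =>
    (hc.contMDiffAt (hU.mem_nhds hy)).mdifferentiableAt (by simp)
  refine ⟨?_, fun V hV => ?_⟩
  · filter_upwards [hU.mem_nhds hx] with y hy
    exact (hcd y hy).smul_section hS.mdifferentiableAt_of_univ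
  · refine (mdifferentiableAt_add_section
      ((hcd x hx).smul_section (smoothOn_nabla hD hV hS).mdifferentiableAt_of_univ)
      ((mdifferentiableAt_mvfderiv hU hx hc hV).smul_section
        hS.mdifferentiableAt_of_univ)).congr_of_eventuallyEq
      ((eventuallyEq_nabla_smul (D := D) (X := V) hU hx hc hS).mono fun y hy => by simp [hy])

lemma curvature_add (hW : TwiceDifferentiableAt D W x) (hW' : TwiceDifferentiableAt D W' x)
    (hY : SmoothOn Y Set.univ) (hZ : SmoothOn Z Set.univ) :
    curvature D Y Z (W + W') x = curvature D Y Z W x + curvature D Y Z W' x := by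
  have key : ∀ V V' : VField E G, SmoothOn V' Set.univ →
      nabla D V (nabla D V' (W + W')) x =
        nabla D V (nabla D V' W) x + nabla D V (nabla D V' W') x := fun V V' hV' => by
    rw [nabla_congr (mdifferentiableAt_add_section (hW.2 V' hV') (hW'.2 V' hV'))
      (eventuallyEq_nabla_add hW hW'), nabla_add (hW.2 V' hV') (hW'.2 V' hV')]
  simp only [curvature, Pi.sub_apply]
  rw [key Y Z hZ, key Z Y hY, nabla_add hW.1.self_of_nhds hW'.1.self_of_nhds]
  abel

lemma curvature_zero : curvature D Y Z 0 x = 0 := by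
  have : ∀ V : VField E G, nabla D V 0 = 0 := fun V => by ext y; simp [nabla]
  simp [curvature, this]

/-- The terms with one derivative of `c` are symmetric in `Y` and `Z` and cancel; `Y(Zc) - Z(Yc)` is
absorbed by the `[Y,Z]` term. -/
lemma curvature_smul [CompleteSpace E] [IsManifold 𝓘(ℝ, E) (minSmoothness ℝ 3) G]
    (hD : CovariantDerivative.ContMDiffCovariantDerivative D ∞)
    (hU : IsOpen U) (hx : x ∈ U) (hc : ContMDiffOn 𝓘(ℝ, E) 𝓘(ℝ, ℝ) ∞ c U)
    (hY : SmoothOn Y Set.univ) (hZ : SmoothOn Z Set.univ) (hS : SmoothOn S Set.univ) :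
    curvature D Y Z (c • S) x = c x • curvature D Y Z S x := by
  have hcx : MDiffAt c x := (hc.contMDiffAt (hU.mem_nhds hx)).mdifferentiableAt (by simp)
  have key : ∀ V V' : VField E G, SmoothOn V' Set.univ →
      nabla D V (nabla D V' (c • S)) x =
        c x • nabla D V (nabla D V' S) x + (d% c x (V x) : ℝ) • nabla D V' S x
        + ((d% c x (V' x) : ℝ) • nabla D V S x
          + (d% (fun y => (d% c y (V' y) : ℝ)) x (V x) : ℝ) • S x) := fun V V' hV' => by
    have h1 := (smoothOn_nabla hD hV' hS).mdifferentiableAt_of_univ (x := x)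
    have h2 := mdifferentiableAt_mvfderiv hU hx hc hV'
    have h3 := hS.mdifferentiableAt_of_univ (x := x)
    rw [nabla_congr (mdifferentiableAt_add_section (hcx.smul_section h1) (h2.smul_section h3))
      (eventuallyEq_nabla_smul hU hx hc hS),
      nabla_add (hcx.smul_section h1) (h2.smul_section h3), nabla_smul hcx h1, nabla_smul h2 h3]
  have hB := mvfderiv_mlieBracket_smul hU hx hc hY hZ hS
  simp only [curvature, Pi.sub_apply]
  rw [key Y Z hZ, key Z Y hY, nabla_smul hcx hS.mdifferentiableAt_of_univ, hB]
  module

lemma curvature_sum_smul [CompleteSpace E] [IsManifold 𝓘(ℝ, E) (minSmoothness ℝ 3) G]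
    (hD : CovariantDerivative.ContMDiffCovariantDerivative D ∞)
    {ι : Type*} (s : Finset ι) {c : ι → G → ℝ} {S : ι → VField E G}
    (hU : IsOpen U) (hx : x ∈ U) (hc : ∀ i, ContMDiffOn 𝓘(ℝ, E) 𝓘(ℝ, ℝ) ∞ (c i) U)
    (hY : SmoothOn Y Set.univ) (hZ : SmoothOn Z Set.univ) (hS : ∀ i, SmoothOn (S i) Set.univ) :
    curvature D Y Z (∑ i ∈ s, c i • S i) x = ∑ i ∈ s, c i x • curvature D Y Z (S i) x := by
  classical
  -- The induction must also carry regularity of the partial sums, needed for additivity.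
  suffices h : TwiceDifferentiableAt D (∑ i ∈ s, c i • S i) x ∧
      curvature D Y Z (∑ i ∈ s, c i • S i) x = ∑ i ∈ s, c i x • curvature D Y Z (S i) x from h.2
  induction s using Finset.induction_on with
  | empty => exact ⟨by simpa using twiceDifferentiableAt_zero, by simpa using curvature_zero⟩
  | insert a s ha ih =>
    have h := twiceDifferentiableAt_smul hD hU hx (hc a) (hS a)
    rw [Finset.sum_insert ha, Finset.sum_insert ha]
    exact ⟨h.add ih.1, by
      rw [curvature_add h ih.1 hY hZ, ih.2, curvature_smul hD hU hx (hc a) hY hZ (hS a)]⟩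

end Curvature

/-! ### Curvature at a point through a left invariant frame. -/

section Group

variable {E : Type u} [NormedAddCommGroup E] [NormedSpace ℝ E] [FiniteDimensional ℝ E]
  {G : Type v} [TopologicalSpace G] [ChartedSpace E G] [Group G] [LieGroup 𝓘(ℝ, E) ∞ G]
  {D : Connection E G} {X X' Y Z W W' S : VField E G} {c : G → ℝ} {U : Set G} {x : G}

/-- The curvature `R(Y, Z) W` at `x` depends only on the value of `W` at `x`. -/
lemma curvature_eq_curvature_mulInvariantVectorField
    (hD : CovariantDerivative.ContMDiffCovariantDerivative D ∞)
    (hU : IsOpen U) (hx : x ∈ U) (hW : SmoothOn W U)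
    (hY : SmoothOn Y Set.univ) (hZ : SmoothOn Z Set.univ) :
    curvature D Y Z W x = curvature D Y Z (mulInvariantVectorField (maurerCartan W x)) x := by
  have : CompleteSpace E := FiniteDimensional.complete ℝ E
  let b : Module.Basis _ ℝ E := Module.finBasis ℝ E
  let L (w : E) : VField E G := mulInvariantVectorField (I := 𝓘(ℝ, E)) (G := G) w
  have hL : ∀ w, SmoothOn (L w) Set.univ := fun w => smoothOn_mulInvariantVectorField w _
  have hsum : ∀ (w : E) (y : G), L w y = ∑ i, b.repr w i • L (b i) y := fun w y => by
    let φ : E →L[ℝ] E := mfderiv 𝓘(ℝ, E) 𝓘(ℝ, E) (fun z : G => y * z) (1 : G)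
    change φ w = ∑ i, b.repr w i • φ (b i)
    calc φ w = φ (∑ i, b.repr w i • b i) := by rw [b.sum_repr]
      _ = _ := by simp only [map_sum, map_smul]
  -- Both fields are expanded in the same global frame: `W` with variable coefficients, the left
  -- invariant one with those coefficients frozen at `x`.
  have h1 : W = ∑ i, (fun y => b.repr (maurerCartan W y) i : G → ℝ) • L (b i) := by
    ext y
    rw [← mulInvariantVectorField_maurerCartan W y]
    simp only [Finset.sum_apply, Pi.smul_apply']
    exact hsum _ y
  have h2 : L (maurerCartan W x) = ∑ i, (fun _ => b.repr (maurerCartan W x) i : G → ℝ) • L (b i) := by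
    ext y
    simp only [Finset.sum_apply, Pi.smul_apply']
    exact hsum _ y
  have hc : ∀ i, ContMDiffOn 𝓘(ℝ, E) 𝓘(ℝ, ℝ) ∞ (fun y => b.repr (maurerCartan W y) i) U :=
    fun i => (LinearMap.toContinuousLinearMap (b.coord i)).contMDiff.comp_contMDiffOn
      (contMDiffOn_maurerCartan hW)
  trans ∑ i, b.repr (maurerCartan W x) i • curvature D Y Z (L (b i)) x
  · conv_lhs => rw [h1]
    exact curvature_sum_smul hD _ hU hx hc hY hZ fun i => hL _
  · symm
    change curvature D Y Z (L (maurerCartan W x)) x = _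
    rw [h2]
    exact curvature_sum_smul hD _ isOpen_univ (Set.mem_univ x) (fun i => contMDiffOn_const) hY hZ
      fun i => hL _

end Group

/-! ### Fields tangent to a parametrized surface have zero bracket. -/

section Surface

variable {E : Type u} [NormedAddCommGroup E] [NormedSpace ℝ E]
  {G : Type v} [TopologicalSpace G] [ChartedSpace E G] [IsManifold 𝓘(ℝ, E) ∞ G]

lemma mpullbackWithin_extChartAt_symm_apply (X : VField E G) {x z : G}
    (hz : z ∈ (extChartAt 𝓘(ℝ, E) x).source) :
    VectorField.mpullbackWithin 𝓘(ℝ, E) 𝓘(ℝ, E) (extChartAt 𝓘(ℝ, E) x).symm X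
      (Set.range 𝓘(ℝ, E)) (extChartAt 𝓘(ℝ, E) x z) =
      mfderiv 𝓘(ℝ, E) 𝓘(ℝ, E) (extChartAt 𝓘(ℝ, E) x) z (X z) := by
  have h1 := mfderiv_extChartAt_comp_mfderivWithin_extChartAt_symm' (I := 𝓘(ℝ, E)) hz
  have h2 := mfderivWithin_extChartAt_symm_comp_mfderiv_extChartAt' (I := 𝓘(ℝ, E)) hz
  have h3 := ContinuousLinearMap.inverse_eq h2 h1
  simp only [VectorField.mpullbackWithin_apply]
  have h4 : ∀ z', z' = z → (X z' : E) = X z := by rintro _ rfl; rfl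
  have h5 := h4 _ ((extChartAt 𝓘(ℝ, E) x).left_inv hz)
  exact congr($h3 $h5)

/-- Differentiate `∂_e f = V ∘ f` at `p` along the line in direction `e'`; the relation is needed on
that line only. -/
lemma fderiv_vectorField_of_surface {P : Type*} [NormedAddCommGroup P] [NormedSpace ℝ P]
    {f : P → E} {p e e' : P} {V : E → E} (hf : ContDiffAt ℝ 2 f p)
    (hV : DifferentiableAt ℝ V (f p))
    (h : ∀ᶠ t : ℝ in nhds 0, fderiv ℝ f (p + t • e') e = V (f (p + t • e'))) :
    V (f p) = fderiv ℝ f p e ∧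
      fderiv ℝ V (f p) (fderiv ℝ f p e') = fderiv ℝ (fderiv ℝ f) p e' e := by
  refine ⟨by simpa using h.self_of_nhds.symm, ?_⟩
  have hl : HasDerivAt (fun t : ℝ => p + t • e') e' 0 := by
    simpa using ((hasDerivAt_id (0 : ℝ)).smul_const e').const_add p
  have hp : p + (0 : ℝ) • e' = p := by simp
  have d1 : HasDerivAt (fun t : ℝ => fderiv ℝ f (p + t • e') e)
      (fderiv ℝ (fderiv ℝ f) p e' e) 0 := by
    have h1 : DifferentiableAt ℝ (fderiv ℝ f) p :=
      (hf.fderiv_right (m := 1) (by norm_num)).differentiableAt (by simp)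
    have := (h1.hasFDerivAt.comp_hasDerivAt_of_eq (0 : ℝ) hl hp.symm).clm_apply
      (hasDerivAt_const 0 e)
    simpa using this
  have d2 : HasDerivAt (fun t : ℝ => V (f (p + t • e')))
      (fderiv ℝ V (f p) (fderiv ℝ f p e')) 0 :=
    hV.hasFDerivAt.comp_hasDerivAt_of_eq (0 : ℝ)
      ((hf.differentiableAt (by simp)).hasFDerivAt.comp_hasDerivAt_of_eq (0 : ℝ) hl hp.symm)
      (by simp)
  exact d2.unique (d1.congr_of_eventuallyEq (h.mono fun t ht => ht.symm))

/-- The bracket becomes the difference of the two mixed second derivatives of `f`, zero by symmetry.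
-/
lemma lieBracketWithin_eq_zero_of_surface {P : Type*} [NormedAddCommGroup P] [NormedSpace ℝ P]
    {f : P → E} {p e₁ e₂ : P} {V W : E → E} {s : Set E} (hs : s = Set.univ)
    (hf : ContDiffAt ℝ 2 f p)
    (hV : V (f p) = fderiv ℝ f p e₁ ∧
      fderiv ℝ V (f p) (fderiv ℝ f p e₂) = fderiv ℝ (fderiv ℝ f) p e₂ e₁)
    (hW : W (f p) = fderiv ℝ f p e₂ ∧
      fderiv ℝ W (f p) (fderiv ℝ f p e₁) = fderiv ℝ (fderiv ℝ f) p e₁ e₂) :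
    VectorField.lieBracketWithin ℝ V W s (f p) = 0 := by
  have hsymm : IsSymmSndFDerivAt ℝ f p := hf.isSymmSndFDerivAt (by simp)
  rw [hs, VectorField.lieBracketWithin_univ, VectorField.lieBracket, hV.1, hW.1, hV.2, hW.2,
    hsymm e₁ e₂, sub_self]

/-- In the chart at `F p` the tangency relations keep their form, which reduces the claim to the
vector space case. -/
lemma mlieBracket_eq_zero_of_surface [CompleteSpace E]
    {P : Type*} [NormedAddCommGroup P] [NormedSpace ℝ P]
    {F : P → G} {p e₁ e₂ : P} {X Y : VField E G}
    (hF : ContMDiffAt 𝓘(ℝ, P) 𝓘(ℝ, E) 2 F p)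
    (hX : MDiffAt (T% X) (F p)) (hY : MDiffAt (T% Y) (F p))
    (hXF : ∀ᶠ t : ℝ in nhds 0, mfderiv 𝓘(ℝ, P) 𝓘(ℝ, E) F (p + t • e₂) e₁ = X (F (p + t • e₂)))
    (hYF : ∀ᶠ t : ℝ in nhds 0, mfderiv 𝓘(ℝ, P) 𝓘(ℝ, E) F (p + t • e₁) e₂ = Y (F (p + t • e₁))) :
    VectorField.mlieBracket 𝓘(ℝ, E) X Y (F p) = 0 := by
  have : IsManifold 𝓘(ℝ, E) 2 G := IsManifold.of_le (n := ∞) (WithTop.coe_le_coe.2 le_top)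
  set φ := extChartAt 𝓘(ℝ, E) (F p) with hφ
  have hsrc : ∀ᶠ q in nhds p, F q ∈ φ.source :=
    hF.continuousAt.eventually (extChartAt_source_mem_nhds (I := 𝓘(ℝ, E)) (F p))
  let f : P → E := φ ∘ F
  have hf : ContDiffAt ℝ 2 f p := by
    rw [← contMDiffAt_iff_contDiffAt]
    exact (contMDiffAt_extChartAt (I := 𝓘(ℝ, E)) (x := F p) (n := 2)).comp p hF
  have hFd : ∀ᶠ q in nhds p, MDifferentiableAt 𝓘(ℝ, P) 𝓘(ℝ, E) F q := by
    filter_upwards [(contMDiffAt_iff_contMDiffAt_nhds (by simp)).1 hF] with q hq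
    exact hq.mdifferentiableAt (by simp)
  have pull : ∀ V : VField E G, MDiffAt (T% V) (F p) → ∀ e e' : P,
      (∀ᶠ t : ℝ in nhds 0, mfderiv 𝓘(ℝ, P) 𝓘(ℝ, E) F (p + t • e') e = V (F (p + t • e'))) →
      let V' : E → E := VectorField.mpullbackWithin 𝓘(ℝ, E) 𝓘(ℝ, E) φ.symm V (Set.range 𝓘(ℝ, E))
      V' (f p) = fderiv ℝ f p e ∧
        fderiv ℝ V' (f p) (fderiv ℝ f p e') = fderiv ℝ (fderiv ℝ f) p e' e := by
    intro V hV e e' hVF V'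
    have hV' : DifferentiableAt ℝ V' (f p) := by
      have := MDifferentiableWithinAt.differentiableWithinAt_mpullbackWithin_vectorField
        (mdifferentiableWithinAt_univ.2 hV)
      have hu : (φ.symm ⁻¹' Set.univ ∩ Set.range 𝓘(ℝ, E)) = Set.univ := by simp
      rw [← hφ, hu] at this
      exact differentiableWithinAt_univ.1 this
    have hline : Filter.Tendsto (fun t : ℝ => p + t • e') (nhds 0) (nhds p) := by
      have : Continuous (fun t : ℝ => p + t • e') := by fun_prop
      simpa using this.tendsto 0
    have heq : ∀ᶠ t : ℝ in nhds 0, fderiv ℝ f (p + t • e') e = V' (f (p + t • e')) := by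
      filter_upwards [hVF, hline.eventually hsrc, hline.eventually hFd] with t h1 h2 h3
      have h4 : V' (f (p + t • e')) = _ := mpullbackWithin_extChartAt_symm_apply V h2
      rw [h4, ← h1, ← mfderiv_eq_fderiv]
      have h5 := mfderiv_comp (I := 𝓘(ℝ, P)) (I' := 𝓘(ℝ, E)) (I'' := 𝓘(ℝ, E)) (p + t • e')
        (mdifferentiableAt_extChartAt (I := 𝓘(ℝ, E)) (by simpa [hφ] using h2)) h3
      exact congr($h5 e)
    exact fderiv_vectorField_of_surface hf hV' heq
  rw [← VectorField.mlieBracketWithin_univ, VectorField.mlieBracketWithin_apply]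
  exact (congrArg _ (lieBracketWithin_eq_zero_of_surface (by simp) hf (pull X hX e₁ e₂ hXF)
    (pull Y hY e₂ e₁ hYF))).trans (map_zero _)

end Surface

/-! ### Right and left invariant fields commute. -/

section Group

variable {E : Type u} [NormedAddCommGroup E] [NormedSpace ℝ E] [CompleteSpace E]
  {G : Type v} [TopologicalSpace G] [ChartedSpace E G] [Group G] [LieGroup 𝓘(ℝ, E) ∞ G]

omit [CompleteSpace E] in
lemma mfderiv_mul_const_of_eq_one {a : E → G} {q v : E} (ha : MDifferentiableAt 𝓘(ℝ, E) 𝓘(ℝ, E) a q)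
    (h1 : a q = 1) (h : G) :
    (mfderiv 𝓘(ℝ, E) 𝓘(ℝ, E) (fun u => a u * h) q v : E) =
      rightInvariantVectorField (E := E) (mfderiv 𝓘(ℝ, E) 𝓘(ℝ, E) a q v : E) h := by
  have h2 := mfderiv_comp (I := 𝓘(ℝ, E)) (I' := 𝓘(ℝ, E)) (I'' := 𝓘(ℝ, E)) q
    (g := fun y : G => y * h)
    ((contMDiff_mul_right (I := 𝓘(ℝ, E)) (n := ∞)).mdifferentiableAt (by simp)) ha
  have h3 : ∀ z : G, z = 1 → (mfderiv 𝓘(ℝ, E) 𝓘(ℝ, E) (fun y : G => y * h) z : E →L[ℝ] E)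
      = mfderiv 𝓘(ℝ, E) 𝓘(ℝ, E) (fun y : G => y * h) 1 := by
    rintro z rfl; rfl
  exact congr($h2 v).trans congr($(h3 _ h1) (mfderiv 𝓘(ℝ, E) 𝓘(ℝ, E) a q v))

omit [CompleteSpace E] in
lemma mfderiv_const_mul_of_eq_one {a : E → G} {q v : E} (ha : MDifferentiableAt 𝓘(ℝ, E) 𝓘(ℝ, E) a q)
    (h1 : a q = 1) (h : G) :
    (mfderiv 𝓘(ℝ, E) 𝓘(ℝ, E) (fun u => h * a u) q v : E) =
      mulInvariantVectorField (I := 𝓘(ℝ, E)) (mfderiv 𝓘(ℝ, E) 𝓘(ℝ, E) a q v : E) h := by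
  have h2 := mfderiv_comp (I := 𝓘(ℝ, E)) (I' := 𝓘(ℝ, E)) (I'' := 𝓘(ℝ, E)) q
    (g := fun y : G => h * y)
    ((contMDiff_mul_left (I := 𝓘(ℝ, E)) (n := ∞)).mdifferentiableAt (by simp)) ha
  have h3 : ∀ z : G, z = 1 → (mfderiv 𝓘(ℝ, E) 𝓘(ℝ, E) (fun y : G => h * y) z : E →L[ℝ] E)
      = mfderiv 𝓘(ℝ, E) 𝓘(ℝ, E) (fun y : G => h * y) 1 := by
    rintro z rfl; rfl
  exact congr($h2 v).trans congr($(h3 _ h1) (mfderiv 𝓘(ℝ, E) 𝓘(ℝ, E) a q v))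

/-- Right invariant and left invariant vector fields commute. -/
lemma mlieBracket_rightInvariantVectorField_mulInvariantVectorField
    (v w : TangentSpace 𝓘(ℝ, E) (1 : G)) :
    VectorField.mlieBracket 𝓘(ℝ, E) (rightInvariantVectorField (E := E) v)
      (mulInvariantVectorField w) = 0 := by
  ext g
  set ψ := extChartAt 𝓘(ℝ, E) (1 : G) with hψ
  let v' : E := mfderiv 𝓘(ℝ, E) 𝓘(ℝ, E) ψ (1 : G) v
  let w' : E := mfderiv 𝓘(ℝ, E) 𝓘(ℝ, E) ψ (1 : G) w
  let p : E × E := (ψ 1, ψ 1)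
  -- The surface `(a, b) ↦ a g b`, with `a` and `b` in a chart at `1`. Varying `a` at `a = 1` gives
  -- the right invariant field, varying `b` at `b = 1` the left invariant one.
  let F : E × E → G := fun q => ψ.symm q.1 * g * ψ.symm q.2
  have hs : ψ.symm (ψ 1) = 1 := extChartAt_to_inv (I := 𝓘(ℝ, E)) (1 : G)
  have hFp : F p = g := by simp [F, p, hs]
  have hψs : ContMDiffAt 𝓘(ℝ, E) 𝓘(ℝ, E) ∞ ψ.symm (ψ 1) :=
    (contMDiffOn_extChartAt_symm (I := 𝓘(ℝ, E)) (n := ∞) (1 : G)).contMDiffAt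
      (extChartAt_target_mem_nhds (I := 𝓘(ℝ, E)) (1 : G))
  have hF : ContMDiffAt 𝓘(ℝ, E × E) 𝓘(ℝ, E) ∞ F p :=
    ((hψs.comp p contDiff_fst.contMDiff.contMDiffAt).mul contMDiffAt_const).mul
      (hψs.comp p contDiff_snd.contMDiff.contMDiffAt)
  have hψd : MDifferentiableAt 𝓘(ℝ, E) 𝓘(ℝ, E) ψ.symm (ψ 1) := hψs.mdifferentiableAt (by simp)
  have hψv : ∀ u : E, (mfderiv 𝓘(ℝ, E) 𝓘(ℝ, E) ψ.symm (ψ 1)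
      (mfderiv 𝓘(ℝ, E) 𝓘(ℝ, E) ψ (1 : G) u : E) : E) = u := fun u => by
    have h := mfderivWithin_extChartAt_symm_comp_mfderiv_extChartAt' (I := 𝓘(ℝ, E))
      (mem_extChartAt_source (I := 𝓘(ℝ, E)) (1 : G))
    rw [ModelWithCorners.range_eq_univ, mfderivWithin_univ] at h
    exact congr($h u)
  have hFd : ∀ᶠ q in nhds p, MDifferentiableAt 𝓘(ℝ, E × E) 𝓘(ℝ, E) F q := by
    filter_upwards [(contMDiffAt_iff_contMDiffAt_nhds (n := 2) (by simp)).1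
      (hF.of_le (WithTop.coe_le_coe.2 le_top))] with q hq
    exact hq.mdifferentiableAt (by simp)
  have hline : ∀ e : E × E, ∀ᶠ t : ℝ in nhds 0,
      MDifferentiableAt 𝓘(ℝ, E × E) 𝓘(ℝ, E) F (p + t • e) := fun e => by
    have : Continuous (fun t : ℝ => p + t • e) := by fun_prop
    exact Filter.Tendsto.eventually (by simpa using this.tendsto 0) hFd
  have hpt : ∀ (u u' : E) (z z' : G), u = u' → z = z' →
      (rightInvariantVectorField (E := E) u z : E) = rightInvariantVectorField (E := E) u' z' := by
    rintro u _ z _ rfl rfl; rfl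
  have hX : ∀ᶠ t : ℝ in nhds 0, mfderiv 𝓘(ℝ, E × E) 𝓘(ℝ, E) F (p + t • (0, w')) (v', 0) =
      rightInvariantVectorField (E := E) v (F (p + t • (0, w'))) := by
    filter_upwards [hline (0, w')] with t ht
    have hq : p + t • ((0 : E), w') = (ψ 1, ψ 1 + t • w') := by simp [p]
    rw [hq] at ht ⊢
    set b := ψ 1 + t • w'
    have h0 := hasFDerivAt_prodMk_left (𝕜 := ℝ) (ψ 1) b
    have h1 := mfderiv_comp (I := 𝓘(ℝ, E)) (I' := 𝓘(ℝ, E × E)) (I'' := 𝓘(ℝ, E)) (ψ 1)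
      (f := fun u : E => (u, b)) ht h0.differentiableAt.mdifferentiableAt
    have h2 := mfderiv_mul_const_of_eq_one (v := v') hψd hs (g * ψ.symm b)
    have h3 : F ∘ (fun u : E => (u, b)) = fun u => ψ.symm u * (g * ψ.symm b) := by
      ext u; simp [F, mul_assoc]
    rw [mfderiv_eq_fderiv, h0.fderiv] at h1
    have h5 : F (ψ 1, b) = g * ψ.symm b := by simp [F, hs]
    exact (congr($h1 v')).symm.trans ((congr(mfderiv 𝓘(ℝ, E) 𝓘(ℝ, E) $h3 (ψ 1) v')).trans
      (h2.trans (hpt _ _ _ _ (hψv v) h5.symm)))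
  have hpt' : ∀ (u u' : E) (z z' : G), u = u' → z = z' →
      (mulInvariantVectorField (I := 𝓘(ℝ, E)) u z : E) =
        mulInvariantVectorField (I := 𝓘(ℝ, E)) u' z' := by
    rintro u _ z _ rfl rfl; rfl
  have hY : ∀ᶠ t : ℝ in nhds 0, mfderiv 𝓘(ℝ, E × E) 𝓘(ℝ, E) F (p + t • (v', 0)) (0, w') =
      mulInvariantVectorField (I := 𝓘(ℝ, E)) w (F (p + t • (v', 0))) := by
    filter_upwards [hline (v', 0)] with t ht
    have hq : p + t • (v', (0 : E)) = (ψ 1 + t • v', ψ 1) := by simp [p]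
    rw [hq] at ht ⊢
    set b := ψ 1 + t • v'
    have h0 := hasFDerivAt_prodMk_right (𝕜 := ℝ) b (ψ 1)
    have h1 := mfderiv_comp (I := 𝓘(ℝ, E)) (I' := 𝓘(ℝ, E × E)) (I'' := 𝓘(ℝ, E)) (ψ 1)
      (f := fun u : E => (b, u)) ht h0.differentiableAt.mdifferentiableAt
    have h2 := mfderiv_const_mul_of_eq_one (v := w') hψd hs (ψ.symm b * g)
    have h3 : F ∘ (fun u : E => (b, u)) = fun u => ψ.symm b * g * ψ.symm u := by
      ext u; simp [F]
    rw [mfderiv_eq_fderiv, h0.fderiv] at h1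
    have h5 : F (b, ψ 1) = ψ.symm b * g := by simp [F, hs]
    exact (congr($h1 w')).symm.trans ((congr(mfderiv 𝓘(ℝ, E) 𝓘(ℝ, E) $h3 (ψ 1) w')).trans
      (h2.trans (hpt' _ _ _ _ (hψv w) h5.symm)))
  have hz : ∀ z : G, z = g → VectorField.mlieBracket 𝓘(ℝ, E)
      (rightInvariantVectorField (E := E) v) (mulInvariantVectorField w) z = 0 →
      VectorField.mlieBracket 𝓘(ℝ, E)
      (rightInvariantVectorField (E := E) v) (mulInvariantVectorField w) g = 0 := by
    rintro _ rfl h; exact h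
  refine hz _ hFp (mlieBracket_eq_zero_of_surface (hF.of_le (WithTop.coe_le_coe.2 le_top))
    ?_ ?_ hX hY)
  · exact (smoothOn_rightInvariantVectorField v _).mdifferentiableAt_of_univ
  · exact (smoothOn_mulInvariantVectorField w _).mdifferentiableAt_of_univ

end Group

/-! ### Full span versus flatness. -/

section Main

variable {E : Type u} [NormedAddCommGroup E] [NormedSpace ℝ E] [FiniteDimensional ℝ E]
  {G : Type v} [TopologicalSpace G] [ChartedSpace E G] [Group G] [LieGroup 𝓘(ℝ, E) ∞ G]
  {D : Connection E G}

omit [FiniteDimensional ℝ E] in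
lemma eq_mulInvariantVectorField {V : VField E G}
    (hV : ∀ g : G, VectorField.mpullback 𝓘(ℝ, E) 𝓘(ℝ, E) (fun x => g * x) V = V) :
    V = mulInvariantVectorField (V 1) := by
  ext g
  rw [mulInvariantVectorField_eq_mpullback g V, hV]

omit [FiniteDimensional ℝ E] in
lemma nabla_mulInvariantVectorField (hD : IsLeftInvariant D)
    (v w : TangentSpace 𝓘(ℝ, E) (1 : G)) :
    nabla D (mulInvariantVectorField v) (mulInvariantVectorField w) =
      mulInvariantVectorField
        (nabla D (mulInvariantVectorField v) (mulInvariantVectorField w) 1) := by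
  refine eq_mulInvariantVectorField fun g => ?_
  rw [hD g _ _ (smoothOn_mulInvariantVectorField v _) (smoothOn_mulInvariantVectorField w _),
    mpullback_mulInvariantVectorField, mpullback_mulInvariantVectorField]

omit [FiniteDimensional ℝ E] [LieGroup 𝓘(ℝ, E) ∞ G] in
lemma mulInvariantVectorField_sub (v w : TangentSpace 𝓘(ℝ, E) (1 : G)) :
    mulInvariantVectorField (v - w) = mulInvariantVectorField v - mulInvariantVectorField w := by
  have h := mulInvariantVectorField_add (v - w) w
  rw [sub_add_cancel] at h
  rw [h, add_sub_cancel_right]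

/-- Left invariant fields are closed under `∇` and the bracket. Hence this curvature vanishes
everywhere once it vanishes at `1`. -/
lemma curvature_mulInvariantVectorField (hD : IsLeftInvariant D)
    (u v w : TangentSpace 𝓘(ℝ, E) (1 : G)) :
    ∃ a : TangentSpace 𝓘(ℝ, E) (1 : G),
      curvature D (mulInvariantVectorField u) (mulInvariantVectorField v)
        (mulInvariantVectorField w) = mulInvariantVectorField a := by
  have : CompleteSpace E := FiniteDimensional.complete ℝ E
  have hn : ∀ v w : TangentSpace 𝓘(ℝ, E) (1 : G), ∃ a : TangentSpace 𝓘(ℝ, E) (1 : G),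
      nabla D (mulInvariantVectorField v) (mulInvariantVectorField w) =
        mulInvariantVectorField a := fun v w => ⟨_, nabla_mulInvariantVectorField hD v w⟩
  obtain ⟨a, ha⟩ := hn v w
  obtain ⟨b, hb⟩ := hn u w
  obtain ⟨a', ha'⟩ := hn u a
  obtain ⟨b', hb'⟩ := hn v b
  obtain ⟨c, hc⟩ := hn (VectorField.mlieBracket 𝓘(ℝ, E) (mulInvariantVectorField u)
    (mulInvariantVectorField v) (1 : G)) w
  exact ⟨a' - b' - c, by
    rw [curvature, ha, hb, ha', hb', ← mulInvariantVector_mlieBracket, hc,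
      mulInvariantVectorField_sub, mulInvariantVectorField_sub]⟩

omit [FiniteDimensional ℝ E] in
lemma solutionSpan_le_localSolutionSpan : solutionSpan D ≤ localSolutionSpan D :=
  Submodule.span_mono fun _ ⟨X, hX, hw⟩ => ⟨Set.univ, X, isOpen_univ, trivial, hX, hw⟩

/-- By linearity in `w` it suffices to take `w = X 1` for a local solution `X`; then `X` may replace
the left invariant field, and both `∇²` terms vanish. -/
lemma curvature_one_eq_zero (hD : IsSLC D) (hspan : localSolutionSpan D = ⊤)
    {Y Z : VField E G} (hY : SmoothOn Y Set.univ) (hZ : SmoothOn Z Set.univ)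
    (w : TangentSpace 𝓘(ℝ, E) (1 : G)) :
    curvature D Y Z (mulInvariantVectorField w) 1 = 0 := by
  have : CompleteSpace E := FiniteDimensional.complete ℝ E
  have hL : ∀ w : TangentSpace 𝓘(ℝ, E) (1 : G),
      SmoothOn (mulInvariantVectorField (I := 𝓘(ℝ, E)) w) Set.univ :=
    fun w => smoothOn_mulInvariantVectorField w _
  have h2 : ∀ w : TangentSpace 𝓘(ℝ, E) (1 : G),
      TwiceDifferentiableAt D (mulInvariantVectorField w) 1 := fun w =>
    ⟨Filter.Eventually.of_forall fun _ => (hL w).mdifferentiableAt_of_univ,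
      fun V hV => (smoothOn_nabla hD.smooth hV (hL w)).mdifferentiableAt_of_univ⟩
  have hw : w ∈ localSolutionSpan D := hspan ▸ Submodule.mem_top
  induction hw using Submodule.span_induction with
  | mem w hw =>
    obtain ⟨U, X, hU, h1, ⟨hXs, hX⟩, rfl⟩ := hw
    have hmc : maurerCartan X 1 = X 1 := by
      rw [← mulInvariantVectorField_one (maurerCartan X 1), mulInvariantVectorField_maurerCartan]
    rw [← hmc, ← curvature_eq_curvature_mulInvariantVectorField hD.smooth hU h1 hXs hY hZ,
      curvature_eq_nablaSq_sub hD.torsionFree hY.mdifferentiableAt_of_univ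
        hZ.mdifferentiableAt_of_univ, hX Y Z hY hZ 1 h1, hX Z Y hZ hY 1 h1, sub_zero]
  | zero =>
    have h := mulInvariantVectorField_sub (E := E) (G := G) 0 0
    rw [sub_zero, sub_self] at h
    rw [h, curvature_zero]
  | add v w _ _ hv hw =>
    rw [mulInvariantVectorField_add, curvature_add (h2 v) (h2 w) hY hZ, hv, hw, add_zero]
  | smul c w _ hw =>
    rw [mulInvariantVectorField_smul]
    refine (curvature_smul (c := fun _ => c) hD.smooth isOpen_univ trivial contMDiffOn_const
      hY hZ (hL w)).trans ?_
    rw [hw, smul_zero]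

lemma isFlat_of_localSolutionSpan_eq_top (hD : IsSLC D) (hspan : localSolutionSpan D = ⊤) :
    IsFlat D := by
  intro Y Z W hY hZ hW
  ext x
  have hL : ∀ w : TangentSpace 𝓘(ℝ, E) (1 : G),
      SmoothOn (mulInvariantVectorField (I := 𝓘(ℝ, E)) w) Set.univ :=
    fun w => smoothOn_mulInvariantVectorField w _
  have hd := fun w => (hL w).mdifferentiableAt_of_univ (x := x)
  have hYd := hY.mdifferentiableAt_of_univ (x := x)
  have hZd := hZ.mdifferentiableAt_of_univ (x := x)
  have hYx := (mulInvariantVectorField_maurerCartan Y x).symm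
  have hZx := (mulInvariantVectorField_maurerCartan Z x).symm
  set v := maurerCartan Y x
  set w := maurerCartan Z x
  rw [curvature_eq_curvature_mulInvariantVectorField hD.smooth isOpen_univ trivial hW hY hZ]
  set u := maurerCartan W x
  -- Tensoriality of curvature in `Y` and `Z` is borrowed from that of `∇²`, by passing to `∇²` and
  -- back.
  rw [curvature_eq_nablaSq_sub hD.torsionFree hYd hZd,
    nablaSq_congr hD.smooth (hL u) hZd (hd w) hYx hZx,
    nablaSq_congr hD.smooth (hL u) hYd (hd v) hZx hYx,
    ← curvature_eq_nablaSq_sub hD.torsionFree (hd v) (hd w)]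
  obtain ⟨a, ha⟩ := curvature_mulInvariantVectorField hD.leftInvariant v w u
  have h1 := curvature_one_eq_zero hD hspan (hL v) (hL w) u
  rw [ha, mulInvariantVectorField_one] at h1
  have h0 := mulInvariantVectorField_sub (E := E) (G := G) 0 0
  rw [sub_zero, sub_self] at h0
  rw [ha, h1, h0]

/-- Right invariant vector fields are infinitesimal affine transformations. -/
lemma isSolutionOn_rightInvariantVectorField (hD : IsSLC D) (hR : IsFlat D)
    (v : TangentSpace 𝓘(ℝ, E) (1 : G)) :
    IsSolutionOn D (rightInvariantVectorField (E := E) v) Set.univ := by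
  have : CompleteSpace E := FiniteDimensional.complete ℝ E
  have hX := smoothOn_rightInvariantVectorField (E := E) v Set.univ
  refine ⟨hX, fun Y Z hY hZ x _ => ?_⟩
  have hL : ∀ w : TangentSpace 𝓘(ℝ, E) (1 : G),
      SmoothOn (mulInvariantVectorField (I := 𝓘(ℝ, E)) w) Set.univ :=
    fun w => smoothOn_mulInvariantVectorField w _
  have hXL := fun w => mlieBracket_rightInvariantVectorField_mulInvariantVectorField (E := E) v w
  rw [nablaSq_congr hD.smooth hX hZ.mdifferentiableAt_of_univ
    (hL (maurerCartan Z x)).mdifferentiableAt_of_univ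
    (mulInvariantVectorField_maurerCartan Y x).symm
    (mulInvariantVectorField_maurerCartan Z x).symm]
  generalize maurerCartan Y x = y
  generalize maurerCartan Z x = z
  set X := rightInvariantVectorField (E := E) v
  have hcomm : ∀ w, nabla D (mulInvariantVectorField w) X =
      nabla D X (mulInvariantVectorField w) := fun w => by
    ext p
    have h := D.torsion_eq_zero_iff.1 hD.torsionFree (hX.mdifferentiableAt_of_univ (x := p))
      (hL w).mdifferentiableAt_of_univ
    rw [hXL w, Pi.zero_apply, sub_eq_zero] at h
    exact h.symm
  have hflat := hR X (mulInvariantVectorField y) (mulInvariantVectorField z) hX (hL y) (hL z)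
  have h0 : ∀ W : VField E G, nabla D 0 W = 0 := fun W => by ext p; simp [nabla]
  simp only [curvature, hXL y, h0, sub_zero] at hflat
  simp only [nablaSq]
  -- `hcomm` also applies to `∇_(L_y) L_z`, because that field is left invariant; what remains is
  -- `-R(X, L_y) L_z`.
  rw [hcomm z, nabla_mulInvariantVectorField hD.leftInvariant y z, hcomm,
    ← nabla_mulInvariantVectorField hD.leftInvariant y z, ← neg_sub, hflat, neg_zero,
    Pi.zero_apply]

lemma solutionSpan_eq_top_of_isFlat (hD : IsSLC D) (hR : IsFlat D) : solutionSpan D = ⊤ :=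
  eq_top_iff.2 fun v _ => Submodule.subset_span
    ⟨_, isSolutionOn_rightInvariantVectorField hD hR v, rightInvariantVectorField_one v⟩

omit [LieGroup 𝓘(ℝ, E) ∞ G] in
-- The truncated subtraction is harmless: it vanishes exactly when `S` has at least the dimension of
-- `E`, hence is everything.
lemma finrank_sub_eq_zero_iff (S : Submodule ℝ (TangentSpace 𝓘(ℝ, E) (1 : G))) :
    ((Module.finrank ℝ E - Module.finrank ℝ S : ℕ) : ℕ∞) = 0 ↔ S = ⊤ := by
  have : FiniteDimensional ℝ (TangentSpace 𝓘(ℝ, E) (1 : G)) := ‹FiniteDimensional ℝ E›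
  have h : Module.finrank ℝ (TangentSpace 𝓘(ℝ, E) (1 : G)) = Module.finrank ℝ E := rfl
  rw [Nat.cast_eq_zero, ← h, Nat.sub_eq_zero_iff_le]
  exact ⟨fun hle => Submodule.eq_top_of_finrank_eq (le_antisymm S.finrank_le hle),
    fun hS => by rw [hS, finrank_top]⟩

end Main
end LeftInvariantGauge

end

theorem mainTheorem10
    {E : Type*} [NormedAddCommGroup E] [NormedSpace ℝ E] [FiniteDimensional ℝ E]
    {G : Type*} [TopologicalSpace G] [ChartedSpace E G] [Group G]
    [LieGroup 𝓘(ℝ, E) ∞ G] :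
    (LeftInvariantGauge.rb E G = 0 ↔
      LeftInvariantGauge.AdmitsLeftInvariantLocallyFlat E G) ∧
    (LeftInvariantGauge.rbLocal E G = 0 ↔
      LeftInvariantGauge.AdmitsLeftInvariantLocallyFlat E G) := by
  open LeftInvariantGauge in
  -- An infimum in `ℕ∞` is zero only if some term is zero, so a vanishing invariant yields a
  -- connection with full span; an empty family would give `⊤`.
  simp only [rb, rbLocal, ENat.iInf_eq_zero, finrank_sub_eq_zero_iff]
  refine ⟨⟨fun ⟨D, h⟩ => ⟨D, D.2, isFlat_of_localSolutionSpan_eq_top D.2 ?_⟩,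
    fun ⟨D, hD, hR⟩ => ⟨⟨D, hD⟩, solutionSpan_eq_top_of_isFlat hD hR⟩⟩,
    ⟨fun ⟨D, h⟩ => ⟨D, D.2, isFlat_of_localSolutionSpan_eq_top D.2 h⟩,
    fun ⟨D, hD, hR⟩ => ⟨⟨D, hD⟩, ?_⟩⟩⟩
  · exact eq_top_iff.2 (h ▸ solutionSpan_le_localSolutionSpan)
  · exact eq_top_iff.2 (solutionSpan_eq_top_of_isFlat hD hR ▸ solutionSpan_le_localSolutionSpan)
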